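/- For a bounded linear operator $T$ on a complex Banach space $X$, let $\alpha(T)=\dim N(T)$ be the dimension of its kernel and $\beta(T)=\operatorname{codim} R(T)$ the codimension of its range. Call $T$ upper semi-Weyl if $R(T)$ is closed, $\alpha(T)<\infty$ and $\operatorname{ind} T=\alpha(T)-\beta(T)\le 0$. Let $\sigma(T)$ be the spectrum of $T$, let $\sigma_a(T)$ be the approximate point spectrum (the set of $\lambda\in\mathbb{C}$ such that $T-\lambda I$ is not bounded below), let $\sigma_{uw}(T)$ be the set of $\lambda\in\mathbb{C}$ such that $T-\lambda I$ is not upper semi-Weyl, let $\sigma_p^0(T)$ be the set of eigenvalues $\lambda$ of $T$ of finite multiplicity, i.e. with $0<\alpha(T-\lambda I)<\infty$, and let $\pi_{00}^a(T)=\operatorname{iso}\sigma_a(T)\cap\sigma_p^0(T)$, where $\operatorname{iso}A$ is the set of isolated points of $A$. The operator $T$ has property $(z)$ if $\sigma(T)\setminus\sigma_{uw}(T)=\pi_{00}^a(T)$. Theorem. Let $X$ and $Y$ be complex Banach spaces, and let $S\in L(X)$ and $T\in L(Y)$ satisfy $\sigma_p^0(S)=\sigma_p^0(T)$. If $S$ and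 $T$ both have property $(z)$, then the direct sum $S\oplus T\in L(X\oplus Y)$ has property $(z)$ if and only if $\sigma_{uw}(S\oplus T)=\sigma_{uw}(S)\cup\sigma_{uw}(T)$. -/

import Mathlib

open scoped ENNReal

noncomputable section

namespace BanachOp

/-- The isolated points of a set `A` of complex numbers: the points of `A` that are not
accumulation points of `A`. -/
def iso (A : Set ℂ) : Set ℂ :=
  {z | z ∈ A ∧ ¬ AccPt z (Filter.principal A)}

variable {X : Type*} [NormedAddCommGroup X] [NormedSpace ℂ X]

/-- `α(T)`: the dimension of the kernel of `T`, in `{0, 1, 2, …, ∞}`. -/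
def alpha (T : X →L[ℂ] X) : ℕ∞ :=
  Cardinal.toENat (Module.rank ℂ (LinearMap.ker (T : X →ₗ[ℂ] X)))

/-- `β(T)`: the codimension of the range of `T`, in `{0, 1, 2, …, ∞}`. -/
def beta (T : X →L[ℂ] X) : ℕ∞ :=
  Cardinal.toENat (Module.rank ℂ (X ⧸ LinearMap.range (T : X →ₗ[ℂ] X)))

/-- The index `α(T) - β(T)`, an extended integer regarded as an extended real number. It is
used only when `α(T)` is finite, so that no `∞ - ∞` occurs. -/
def index (T : X →L[ℂ] X) : EReal :=
  ((alpha T : ℝ≥0∞) : EReal) - ((beta T : ℝ≥0∞) : EReal)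

/-- `T` is upper semi-Fredholm: its range is closed and its kernel is finite dimensional. -/
def IsUpperSemiFredholm (T : X →L[ℂ] X) : Prop :=
  IsClosed (Set.range T) ∧ alpha T < ⊤

/-- `T` is upper semi-Weyl: upper semi-Fredholm of index at most zero. -/
def IsUpperSemiWeyl (T : X →L[ℂ] X) : Prop :=
  IsUpperSemiFredholm T ∧ index T ≤ 0

/-- The translate `T - λI`. -/
def shift (T : X →L[ℂ] X) (z : ℂ) : X →L[ℂ] X :=
  T - z • ContinuousLinearMap.id ℂ X

/-- `σ_uw(T)`: the upper semi-Weyl spectrum. -/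
def upperSemiWeylSpectrum (T : X →L[ℂ] X) : Set ℂ :=
  {z | ¬ IsUpperSemiWeyl (shift T z)}

/-- `σ_a(T)`: the approximate point spectrum, the `λ` for which `T - λI` is not bounded below. -/
def approximateSpectrum (T : X →L[ℂ] X) : Set ℂ :=
  {z | ¬ ∃ c : ℝ, 0 < c ∧ ∀ x : X, c * ‖x‖ ≤ ‖shift T z x‖}

/-- `σ_p⁰(T)`: the eigenvalues of `T` of finite (geometric) multiplicity. -/
def finiteEigenvalues (T : X →L[ℂ] X) : Set ℂ :=
  {z | Module.End.HasEigenvalue (T : X →ₗ[ℂ] X) z ∧ alpha (shift T z) < ⊤}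

/-- `π_00^a(T)`: the isolated points of `σ_a(T)` that are eigenvalues of finite multiplicity. -/
def isolatedFiniteEigenvalues (T : X →L[ℂ] X) : Set ℂ :=
  iso (approximateSpectrum T) ∩ finiteEigenvalues T

/-- Property `(z)`: `σ(T) \ σ_uw(T) = π_00^a(T)`. -/
def PropertyZ (T : X →L[ℂ] X) : Prop :=
  spectrum ℂ T \ upperSemiWeylSpectrum T = isolatedFiniteEigenvalues T

end BanachOp

end

namespace BanachOp

/-! ### Isolated points -/

/-! Let W = σ_uw(S) ∪ σ_uw(T). Kernel dimensions add, so S ⊕ T has the same finite eigenvalues as S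
and T. Each lies in both σ_a(S) and σ_a(T), hence is isolated in their union σ_a(S ⊕ T) iff isolated
in both. Thus π_00^a(S ⊕ T) = π_00^a(S) ∩ π_00^a(T), which property (z) of S and T turns into σ(S ⊕
T) \ W (`isolatedFiniteEigenvalues_prodMap_eq_diff`). Property (z) for S ⊕ T then says that σ_uw(S ⊕
T) and W have the same complement in σ(S ⊕ T); both lie in that spectrum, so they coincide. -/

theorem mem_iso_union_iff {A B : Set ℂ} {z : ℂ} (hA : z ∈ A) (hB : z ∈ B) :
    z ∈ iso (A ∪ B) ↔ z ∈ iso A ∧ z ∈ iso B := by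
  simp only [iso, Set.mem_ofPred_eq, ← Filter.sup_principal, accPt_sup, Set.mem_union]
  tauto

/-! ### Kernel, range and spectra of a single operator -/

section Single

variable {X : Type*} [NormedAddCommGroup X] [NormedSpace ℂ X]

theorem index_nonpos_iff (T : X →L[ℂ] X) : index T ≤ 0 ↔ alpha T ≤ beta T := by
  rw [index, EReal.sub_nonpos, EReal.coe_ennreal_le_coe_ennreal_iff, ENat.toENNReal_le]

theorem alpha_eq_zero_iff (T : X →L[ℂ] X) : alpha T = 0 ↔ Function.Injective T := by
  rw [alpha, Cardinal.toENat_eq_zero, rank_zero_iff,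
    Submodule.subsingleton_iff_eq_bot, LinearMap.ker_eq_bot]
  rfl

theorem mem_finiteEigenvalues_iff (T : X →L[ℂ] X) (z : ℂ) :
    z ∈ finiteEigenvalues T ↔ alpha (shift T z) ≠ 0 ∧ alpha (shift T z) < ⊤ := by
  have h : Module.End.HasEigenvalue (T : X →ₗ[ℂ] X) z ↔ alpha (shift T z) ≠ 0 := by
    rw [Module.End.hasEigenvalue_iff, Ne, not_iff_not, alpha, Cardinal.toENat_eq_zero,
      rank_zero_iff, Submodule.subsingleton_iff_eq_bot,
      Module.End.eigenspace_def]
    rfl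
  simp only [finiteEigenvalues, Set.mem_ofPred_eq, h]

theorem finiteEigenvalues_subset_approximateSpectrum (T : X →L[ℂ] X) :
    finiteEigenvalues T ⊆ approximateSpectrum T := by
  rintro z hz ⟨c, hc, hcx⟩
  refine ((mem_finiteEigenvalues_iff T z).1 hz).1 ((alpha_eq_zero_iff _).2 ?_)
  refine (injective_iff_map_eq_zero _).2 fun x hx => ?_
  have h := hcx x
  rw [hx, norm_zero] at h
  exact norm_le_zero_iff.1 (nonpos_of_mul_nonpos_right h hc)

theorem mem_spectrum_iff [CompleteSpace X] (T : X →L[ℂ] X) (z : ℂ) :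
    z ∈ spectrum ℂ T ↔ ¬ Function.Bijective (shift T z) := by
  have h : shift T z = -(algebraMap ℂ (X →L[ℂ] X) z - T) := by
    ext x
    simp [shift, Algebra.algebraMap_eq_smul_one]
  rw [spectrum.mem_iff, ← ContinuousLinearMap.isUnit_iff_bijective, h, IsUnit.neg_iff]

theorem finiteEigenvalues_subset_spectrum [CompleteSpace X] (T : X →L[ℂ] X) :
    finiteEigenvalues T ⊆ spectrum ℂ T := fun z hz =>
  (mem_spectrum_iff T z).2 fun h =>
    ((mem_finiteEigenvalues_iff T z).1 hz).1 ((alpha_eq_zero_iff _).2 h.1)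

theorem upperSemiWeylSpectrum_subset_spectrum [CompleteSpace X] (T : X →L[ℂ] X) :
    upperSemiWeylSpectrum T ⊆ spectrum ℂ T := by
  intro z hz
  rw [mem_spectrum_iff]
  intro h
  have h0 := (alpha_eq_zero_iff _).2 h.1
  refine hz ⟨⟨?_, ?_⟩, ?_⟩
  · rw [h.2.range_eq]
    exact isClosed_univ
  · simp [h0]
  · simp [index_nonpos_iff, h0]

end Single

/-! ### Direct sums -/

section DirectSum

variable {X Y : Type*} [NormedAddCommGroup X] [NormedSpace ℂ X]
  [NormedAddCommGroup Y] [NormedSpace ℂ Y]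

theorem shift_prodMap (S : X →L[ℂ] X) (T : Y →L[ℂ] Y) (z : ℂ) :
    shift (S.prodMap T) z = (shift S z).prodMap (shift T z) := rfl

theorem alpha_prodMap (S : X →L[ℂ] X) (T : Y →L[ℂ] Y) :
    alpha (S.prodMap T) = alpha S + alpha T := by
  have h : LinearMap.ker (S.prodMap T : X × Y →ₗ[ℂ] X × Y) =
      (LinearMap.ker (S : X →ₗ[ℂ] X)).prod (LinearMap.ker (T : Y →ₗ[ℂ] Y)) :=
    LinearMap.ker_prodMap _ _
  let e : (LinearMap.ker (S : X →ₗ[ℂ] X)).prod (LinearMap.ker (T : Y →ₗ[ℂ] Y)) ≃ₗ[ℂ]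
      LinearMap.ker (S : X →ₗ[ℂ] X) × LinearMap.ker (T : Y →ₗ[ℂ] Y) :=
    { toFun := fun x => (⟨x.1.1, x.2.1⟩, ⟨x.1.2, x.2.2⟩)
      invFun := fun x => ⟨(x.1.1, x.2.1), x.1.2, x.2.2⟩
      map_add' := fun _ _ => rfl
      map_smul' := fun _ _ => rfl }
  rw [alpha, h, e.rank_eq, rank_prod, map_add,
    Cardinal.toENat_lift, Cardinal.toENat_lift]
  rfl

theorem beta_prodMap (S : X →L[ℂ] X) (T : Y →L[ℂ] Y) :
    beta (S.prodMap T) = beta S + beta T := by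
  set p := LinearMap.range (S : X →ₗ[ℂ] X) with hp
  set q := LinearMap.range (T : Y →ₗ[ℂ] Y) with hq
  -- Viewing the range as a kernel lets the first isomorphism theorem split the quotient as a
  -- product.
  have h : LinearMap.range (S.prodMap T : X × Y →ₗ[ℂ] X × Y) =
      LinearMap.ker (p.mkQ.prodMap q.mkQ) := by
    rw [LinearMap.ker_prodMap, Submodule.ker_mkQ, Submodule.ker_mkQ]
    exact LinearMap.range_prodMap _ _
  have hsurj : Function.Surjective (p.mkQ.prodMap q.mkQ) :=
    p.mkQ_surjective.prodMap q.mkQ_surjective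
  rw [beta, h, (LinearMap.quotKerEquivOfSurjective _ hsurj).rank_eq, rank_prod, map_add,
    Cardinal.toENat_lift, Cardinal.toENat_lift]
  rfl

theorem IsUpperSemiWeyl.prodMap {S : X →L[ℂ] X} {T : Y →L[ℂ] Y} (hS : IsUpperSemiWeyl S)
    (hT : IsUpperSemiWeyl T) : IsUpperSemiWeyl (S.prodMap T) := by
  refine ⟨⟨?_, ?_⟩, ?_⟩
  · have h : Set.range (S.prodMap T) = Set.range S ×ˢ Set.range T := Set.range_prodMap
    rw [h]
    exact hS.1.1.prod hT.1.1
  · rw [alpha_prodMap]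
    exact ENat.add_lt_top.2 ⟨hS.1.2, hT.1.2⟩
  · rw [index_nonpos_iff, alpha_prodMap, beta_prodMap]
    exact add_le_add ((index_nonpos_iff S).1 hS.2) ((index_nonpos_iff T).1 hT.2)

/-- This half of the equality is automatic. The other half is the real condition: a positive index
of one summand may be offset by a negative index of the other. -/
theorem upperSemiWeylSpectrum_prodMap_subset (S : X →L[ℂ] X) (T : Y →L[ℂ] Y) :
    upperSemiWeylSpectrum (S.prodMap T) ⊆
      upperSemiWeylSpectrum S ∪ upperSemiWeylSpectrum T := by
  intro z hz
  by_contra h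
  rw [Set.mem_union, not_or] at h
  exact hz (IsUpperSemiWeyl.prodMap (not_not.1 h.1) (not_not.1 h.2))

theorem spectrum_prodMap [CompleteSpace X] [CompleteSpace Y] (S : X →L[ℂ] X) (T : Y →L[ℂ] Y) :
    spectrum ℂ (S.prodMap T) = spectrum ℂ S ∪ spectrum ℂ T := by
  ext z
  rw [Set.mem_union, mem_spectrum_iff, mem_spectrum_iff, mem_spectrum_iff, ← not_and_or,
    not_iff_not, shift_prodMap]
  exact Prod.map_bijective (f := shift S z) (g := shift T z)

theorem approximateSpectrum_prodMap (S : X →L[ℂ] X) (T : Y →L[ℂ] Y) :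
    approximateSpectrum (S.prodMap T) = approximateSpectrum S ∪ approximateSpectrum T := by
  ext z
  simp only [approximateSpectrum, Set.mem_union, Set.mem_ofPred_eq, ← not_and_or, not_iff_not,
    shift_prodMap]
  constructor
  · rintro ⟨c, hc, h⟩
    refine ⟨⟨c, hc, fun x => ?_⟩, ⟨c, hc, fun y => ?_⟩⟩
    · simpa [Prod.norm_def] using h (x, 0)
    · simpa [Prod.norm_def] using h (0, y)
  · rintro ⟨⟨c, hc, hS⟩, ⟨d, hd, hT⟩⟩
    refine ⟨min c d, lt_min hc hd, fun p => ?_⟩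
    rw [Prod.norm_def, Prod.norm_def, mul_max_of_nonneg _ _ (lt_min hc hd).le]
    refine max_le_max ?_ ?_
    · exact (mul_le_mul_of_nonneg_right (min_le_left c d) (norm_nonneg _)).trans (hS p.1)
    · exact (mul_le_mul_of_nonneg_right (min_le_right c d) (norm_nonneg _)).trans (hT p.2)

/-- If α(S - λI) + α(T - λI) is finite and nonzero, both terms are finite and one is nonzero; the
hypothesis then makes the other nonzero. -/
theorem finiteEigenvalues_prodMap {S : X →L[ℂ] X} {T : Y →L[ℂ] Y}
    (h : finiteEigenvalues S = finiteEigenvalues T) :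
    finiteEigenvalues (S.prodMap T) = finiteEigenvalues S := by
  ext z
  have hz := Set.ext_iff.1 h z
  rw [mem_finiteEigenvalues_iff, mem_finiteEigenvalues_iff] at hz
  rw [mem_finiteEigenvalues_iff, mem_finiteEigenvalues_iff, shift_prodMap, alpha_prodMap,
    ENat.add_lt_top, Ne, add_eq_zero]
  tauto

theorem isolatedFiniteEigenvalues_prodMap {S : X →L[ℂ] X} {T : Y →L[ℂ] Y}
    (h : finiteEigenvalues S = finiteEigenvalues T) :
    isolatedFiniteEigenvalues (S.prodMap T) =
      isolatedFiniteEigenvalues S ∩ isolatedFiniteEigenvalues T := by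
  ext z
  simp only [isolatedFiniteEigenvalues, finiteEigenvalues_prodMap h, Set.mem_inter_iff, ← h,
    approximateSpectrum_prodMap]
  by_cases hz : z ∈ finiteEigenvalues S
  · rw [mem_iso_union_iff (finiteEigenvalues_subset_approximateSpectrum S hz)
      (finiteEigenvalues_subset_approximateSpectrum T (h ▸ hz))]
    tauto
  · tauto

/-- For operators with property `(z)` and the same eigenvalues of finite multiplicity,
`π_00^a(S ⊕ T)` is the complement of `σ_uw(S) ∪ σ_uw(T)` in `σ(S ⊕ T)`. -/
theorem isolatedFiniteEigenvalues_prodMap_eq_diff [CompleteSpace X] [CompleteSpace Y]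
    {S : X →L[ℂ] X} {T : Y →L[ℂ] Y} (h : finiteEigenvalues S = finiteEigenvalues T)
    (hS : PropertyZ S) (hT : PropertyZ T) :
    isolatedFiniteEigenvalues (S.prodMap T) =
      spectrum ℂ (S.prodMap T) \ (upperSemiWeylSpectrum S ∪ upperSemiWeylSpectrum T) := by
  rw [isolatedFiniteEigenvalues_prodMap h, spectrum_prodMap, ← hS, ← hT]
  ext z
  -- By (z) such a point is a finite eigenvalue of S, hence of T. So a point of σ(S) ∪ σ(T) outside
  -- both σ_uw lies in both spectra.
  have hSz : z ∈ spectrum ℂ S \ upperSemiWeylSpectrum S → z ∈ spectrum ℂ T := fun hz =>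
    finiteEigenvalues_subset_spectrum T (h ▸ (hS.subset hz).2)
  have hTz : z ∈ spectrum ℂ T \ upperSemiWeylSpectrum T → z ∈ spectrum ℂ S := fun hz =>
    finiteEigenvalues_subset_spectrum S (h ▸ (hT.subset hz).2)
  simp only [Set.mem_inter_iff, Set.mem_sdiff, Set.mem_union] at hSz hTz ⊢
  tauto

end DirectSum

end BanachOp

open BanachOp in
theorem theorem3p9 {X Y : Type*}
    [NormedAddCommGroup X] [NormedSpace ℂ X] [CompleteSpace X]
    [NormedAddCommGroup Y] [NormedSpace ℂ Y] [CompleteSpace Y]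
    (S : X →L[ℂ] X) (T : Y →L[ℂ] Y)
    (hp : finiteEigenvalues S = finiteEigenvalues T)
    (hS : PropertyZ S) (hT : PropertyZ T) :
    PropertyZ (S.prodMap T) ↔
      upperSemiWeylSpectrum (S.prodMap T) =
        upperSemiWeylSpectrum S ∪ upperSemiWeylSpectrum T := by
  rw [PropertyZ, isolatedFiniteEigenvalues_prodMap_eq_diff hp hS hT]
  have hsub : upperSemiWeylSpectrum S ∪ upperSemiWeylSpectrum T ⊆ spectrum ℂ (S.prodMap T) := by
    rw [spectrum_prodMap]
    exact Set.union_subset_union (upperSemiWeylSpectrum_subset_spectrum S)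
      (upperSemiWeylSpectrum_subset_spectrum T)
  constructor
  · intro h
    -- Complementation within σ(S ⊕ T) is an involution on its subsets.
    rw [← Set.sdiff_sdiff_cancel_left hsub, ← h,
      Set.sdiff_sdiff_cancel_left (upperSemiWeylSpectrum_subset_spectrum _)]
  · intro h
    rw [h]
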